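/- Let $N\ge 2$ and let $u\in C^1(\mathbb{R}^N)$ be a real-valued function with $\nabla u\in L^N(\mathbb{R}^N)$, that is, $\int_{\mathbb{R}^N}|\nabla u|^N\,dx<\infty$. Set \[ \mathbf S=\{x\in\mathbb{R}^N:\nabla u(x)=0\}. \] Assume one of the following: (i) $\mathbf S$ is compact; (ii) $\mathbf S$ is connected and $u\in C^N(\mathbb{R}^N)$. Then there exists $L\in[-\infty,+\infty]$ such that \[ \lim_{|x|\to+\infty}u(x)=L . \] -/

import Mathlib

open Filter Topology MeasureTheory

/-!
The limit exists because `u` oscillates little on a sequence of large spheres, and because the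
extrema of `u` between two spheres are under control.

*Small oscillation.* It is convenient to use the spheres of the sup norm on `Fin (n + 1) → ℝ`,
where `N = n + 1`, whose faces are flat `n`-dimensional cubes. Since `n < N`, Morrey's inequality
(`enorm_sub_le_morrey`) bounds the oscillation of a function on a cube of side `2ρ` by
`C (2ρ ∫ ‖w'‖ ^ N) ^ (1 / N)`. By Fubini some radius `r ∈ [R, 2R]` has
`∫ ‖∇u‖ ^ N ≤ C R⁻¹ ∫_{‖x‖ ≥ R} ‖∇u‖ ^ N` on each of its faces, and for this `r` the powers of `R`
cancel: the oscillation is at most `C (∫_{‖x‖ ≥ R} ‖∇u‖ ^ N) ^ (1 / N)`, which tends to `0`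
(`exists_radius_sphere_osc_le`).

*Bounded critical set.* Outside a ball there are no local extrema, so the maximum `M r` of `u` over
the sphere of radius `r` satisfies `M b ≤ max (M a) (M c)` for `a < b < c`. Such a function is
eventually monotone and has a limit in `[-∞, ∞]`; so has the minimum, and the two limits agree
because the oscillation is small on a sequence of spheres.

*Unbounded connected critical set.* The critical set meets every large sphere, and `u` is equal to a
constant `c` on it (see below). Hence `u` is close to `c` on the spheres of small oscillation, and
between two of them the extrema of `u` are attained on the spheres or at critical points.

*Critical values.* That `u` is constant on a connected critical set follows from the Morse-Sard
theorem for real functions of class `C ^ N` on `ℝ ^ N` (`volume_image_critical_eq_zero`): a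
connected null set of values is a point. At this sharp regularity it is proved through Morse's
decomposition (`hasMorseCover`): every set `A` is covered by countably many pieces, parametrized so
that each `C ^ k` function vanishing on `A` vanishes to order `o(‖y - x‖ ^ k)` in the parameter at
the points of the piece. For `A` the critical set, `k = N - 1`, and the derivative of `u`, one
integration shows that `u` varies by `o(‖y - x‖ ^ N)`, so that the image of the piece is null.
-/

open Asymptotics Set

theorem isLittleO_sub_pow_succ_of_fderiv {E F : Type*} [NormedAddCommGroup E] [NormedSpace ℝ E]
    [NormedAddCommGroup F] [NormedSpace ℝ F] {f : E → F} {x : E} {k : ℕ}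
    (hf : ∀ᶠ y in 𝓝 x, DifferentiableAt ℝ f y)
    (h : (fun y => fderiv ℝ f y) =o[𝓝 x] fun y => ‖y - x‖ ^ k) :
    (fun y => f y - f x) =o[𝓝 x] fun y => ‖y - x‖ ^ (k + 1) := by
  rw [isLittleO_iff] at h ⊢
  intro c hc
  obtain ⟨δ, hδ, hball⟩ := Metric.eventually_nhds_iff_ball.1 (hf.and (h hc))
  filter_upwards [Metric.ball_mem_nhds x hδ] with y hy
  have hsub : segment ℝ x y ⊆ Metric.ball x δ :=
    (convex_ball x δ).segment_subset (Metric.mem_ball_self hδ) hy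
  have := (convex_segment x y).norm_image_sub_le_of_norm_fderiv_le (𝕜 := ℝ) (f := f)
    (C := c * ‖y - x‖ ^ k)
    (fun z hz => (hball z (hsub hz)).1) (fun z hz => ?_)
    (left_mem_segment ℝ x y) (right_mem_segment ℝ x y)
  · rw [norm_pow, norm_norm, pow_succ, ← mul_assoc]
    exact this
  · refine (hball z (hsub hz)).2.trans ?_
    rw [norm_pow, norm_norm]
    gcongr
    exact norm_sub_le_of_mem_segment hz

/-! ### Morse's decomposition -/

/-- `IsMorsePiece k A B` says that `B` is contained in the image `φ '' T ⊆ A` of a set of points at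
which `φ` is `C ^ 1`, where `φ` flattens the functions vanishing on `A`: if `f` is `C ^ k` at the
points of `A` and vanishes on `A`, then `f (φ y) = o(‖y - x‖ ^ k)` as `y → x`, for each `x ∈ T`.

Here `y` ranges over a full neighbourhood of `x`, not over `T`. The parameter space is always the
ambient space `E`: a parametrization of lower dimension is precomposed with a linear projection.
The functions `f` take values in any normed space, so that the notion applies to derivatives. -/
def IsMorsePiece {E : Type} [NormedAddCommGroup E] [NormedSpace ℝ E] (k : ℕ) (A B : Set E) : Prop :=
  ∃ (φ : E → E) (T : Set E), B ⊆ φ '' T ∧ MapsTo φ T A ∧ (∀ x ∈ T, ContDiffAt ℝ 1 φ x) ∧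
    ∀ (F : Type) [NormedAddCommGroup F] [NormedSpace ℝ F] (f : E → F),
      (∀ a ∈ A, ContDiffAt ℝ k f a ∧ f a = 0) →
        ∀ x ∈ T, (fun y => f (φ y)) =o[𝓝 x] fun y => ‖y - x‖ ^ k

section

variable {E : Type} [NormedAddCommGroup E] [NormedSpace ℝ E]

theorem isMorsePiece_zero (A : Set E) : IsMorsePiece 0 A A := by
  refine ⟨id, A, by simp, mapsTo_id _, fun x _ => contDiffAt_id, fun F _ _ f hf x hx => ?_⟩
  have h := (hf x hx).1.continuousAt.tendsto
  rw [(hf x hx).2] at h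
  simpa [isLittleO_one_iff] using h

/-- The points of `A` at which every real function vanishing on `A`, and of class `C ^ k` at the
points of `A`, has derivative zero. -/
def flatPart (k : ℕ) (A : Set E) : Set E :=
  {x ∈ A | ∀ f : E → ℝ, (∀ a ∈ A, ContDiffAt ℝ k f a ∧ f a = 0) → fderiv ℝ f x = 0}

theorem fderiv_eq_zero_of_mem_flatPart {k : ℕ} {A : Set E} {x : E} (hx : x ∈ flatPart (k + 1) A)
    {F : Type*} [NormedAddCommGroup F] [NormedSpace ℝ F] {f : E → F}
    (hf : ∀ a ∈ A, ContDiffAt ℝ (k + 1 : ℕ) f a ∧ f a = 0) : fderiv ℝ f x = 0 := by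
  ext v
  by_contra hne
  obtain ⟨ℓ, hℓ⟩ := SeparatingDual.exists_ne_zero (R := ℝ) hne
  apply hℓ
  have h0 := hx.2 (fun y => ℓ (f y)) fun a ha =>
    ⟨ℓ.contDiff.contDiffAt.comp a (hf a ha).1, by simp [(hf a ha).2]⟩
  have hd : DifferentiableAt ℝ f x := (hf x hx.1).1.differentiableAt (by simp)
  have := congrArg (fun L => L v) ((ℓ.hasFDerivAt.comp x hd.hasFDerivAt).fderiv.symm.trans h0)
  simpa using this

theorem fderiv_comp_isLittleO {F : Type*} [NormedAddCommGroup F] [NormedSpace ℝ F]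
    {f : E → F} {φ : E → E} {x : E} {k : ℕ} (hφ : ContDiffAt ℝ 1 φ x)
    (hf : ∀ᶠ y in 𝓝 (φ x), DifferentiableAt ℝ f y)
    (h : (fun y => fderiv ℝ f (φ y)) =o[𝓝 x] fun y => ‖y - x‖ ^ k) :
    (fun y => f (φ y) - f (φ x)) =o[𝓝 x] fun y => ‖y - x‖ ^ (k + 1) := by
  have hφd : ∀ᶠ y in 𝓝 x, DifferentiableAt ℝ φ y :=
    (hφ.eventually (by simp)).mono fun y hy => hy.differentiableAt (by simp)
  have hfd := hφ.continuousAt.eventually hf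
  refine isLittleO_sub_pow_succ_of_fderiv (f := fun y => f (φ y)) ?_ ?_
  · filter_upwards [hφd, hfd] with y h1 h2 using h2.comp y h1
  · have hb : (fun y => fderiv ℝ φ y) =O[𝓝 x] fun _ => (1 : ℝ) :=
      (hφ.continuousAt_fderiv (by simp)).isBigO_one ℝ
    have hp := (h.norm_left.mul_isBigO hb.norm_left)
    simp only [mul_one] at hp
    refine IsBigO.trans_isLittleO (IsBigO.of_bound 1 ?_) hp
    filter_upwards [hφd, hfd] with y h1 h2
    have : fderiv ℝ (fun y => f (φ y)) y = (fderiv ℝ f (φ y)).comp (fderiv ℝ φ y) :=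
      fderiv_comp y h2 h1
    rw [this, one_mul, norm_mul, norm_norm, norm_norm]
    exact ContinuousLinearMap.opNorm_comp_le _ _

/-- The derivative of a `C ^ (k + 1)` function vanishing on `A` is `C ^ k` and vanishes on the flat
part of `A`; integrating its `o(‖y - x‖ ^ k)` estimate gains one order for the function. -/
theorem IsMorsePiece.of_flatPart {k : ℕ} {A B : Set E}
    (h : IsMorsePiece k (flatPart (k + 1) A) B) : IsMorsePiece (k + 1) A B := by
  obtain ⟨φ, T, hB, hT, hφ, hlit⟩ := h
  refine ⟨φ, T, hB, fun x hx => (hT hx).1, hφ, fun F _ _ f hf x hx => ?_⟩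
  have hC := (hf (φ x) (hT hx).1).1
  have h1 := hlit (E →L[ℝ] F) (fderiv ℝ f) (fun a ha =>
    ⟨(hf a ha.1).1.fderiv_right (by norm_cast), fderiv_eq_zero_of_mem_flatPart ha hf⟩) x hx
  have := fderiv_comp_isLittleO (hφ x hx)
    ((hC.eventually (by simp)).mono fun y hy => hy.differentiableAt (by simp)) h1
  simpa [(hf (φ x) (hT hx).1).2] using this

/-- A piece in a space `K` is carried to a piece in `E` by a `C ^ k` map `g : K → E`; the new
parametrization is precomposed with `P` so that its parameter space is `E`. -/
theorem IsMorsePiece.image {K : Type} [NormedAddCommGroup K] [NormedSpace ℝ K] {k : ℕ}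
    (hk : k ≠ 0) {A : Set E} {A' B : Set K} (g : K → E) (P : E →L[ℝ] K)
    (hP : Function.Surjective P) (hA' : ∀ z ∈ A', g z ∈ A ∧ ContDiffAt ℝ k g z)
    (h : IsMorsePiece k A' B) : IsMorsePiece k A (g '' B) := by
  obtain ⟨φ, T, hB, hT, hφ, hlit⟩ := h
  refine ⟨fun y => g (φ (P y)), P ⁻¹' T, ?_, fun x hx => (hA' _ (hT hx)).1, fun x hx => ?_,
    fun F _ _ f hf x hx => ?_⟩
  · rintro _ ⟨b, hb, rfl⟩
    obtain ⟨t, ht, rfl⟩ := hB hb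
    obtain ⟨e, rfl⟩ := hP t
    exact ⟨e, ht, rfl⟩
  · have h1 : ContDiffAt ℝ 1 g (φ (P x)) :=
      (hA' _ (hT hx)).2.of_le (by exact_mod_cast Nat.one_le_iff_ne_zero.2 hk)
    exact h1.comp x ((hφ _ hx).comp x P.contDiff.contDiffAt)
  · have h1 := hlit F (fun z => f (g z)) (fun z hz =>
      ⟨(hf _ (hA' z hz).1).1.comp z (hA' z hz).2, (hf _ (hA' z hz).1).2⟩) (P x) hx
    have h2 := h1.comp_tendsto (P.continuous.tendsto x)
    refine h2.trans_isBigO (IsBigO.of_bound (‖P‖ ^ k) (Eventually.of_forall fun y => ?_))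
    simp only [Function.comp_apply, norm_pow, norm_norm, ← mul_pow, ← map_sub]
    gcongr
    exact P.le_opNorm _

/-- `B` is covered by countably many Morse pieces of order `k` relative to `A`. -/
def HasMorseCover (k : ℕ) (A B : Set E) : Prop :=
  ∃ 𝓑 : Set (Set E), 𝓑.Countable ∧ B ⊆ ⋃₀ 𝓑 ∧ ∀ C ∈ 𝓑, IsMorsePiece k A C

/-- Near a point `x` of `A` outside its flat part, `A` lies in the zero set of a `C ^ k` function `f`
with `f' x ≠ 0`, which is the image of a `C ^ k` map `g` on the hyperplane `ker f'`. Pieces of `A`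
are thus obtained from a decomposition of `g ⁻¹' A` in one dimension less. -/
theorem exists_nhds_hasMorseCover [FiniteDimensional ℝ E] {k : ℕ} (hk : k ≠ 0) {A : Set E}
    (ih : ∀ V : Submodule ℝ E, Module.finrank ℝ V < Module.finrank ℝ E →
      ∀ A' : Set V, HasMorseCover k A' A')
    {x : E} (hx : x ∈ A) (hx' : x ∉ flatPart k A) :
    ∃ U ∈ 𝓝[A] x, HasMorseCover k A U := by
  simp only [flatPart, mem_ofPred_eq, not_and, not_forall] at hx'
  obtain ⟨f, hf, hne⟩ := hx' hx
  have hstrict : HasStrictFDerivAt f (fderiv ℝ f x) x :=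
    (hf x hx).1.hasStrictFDerivAt (by exact_mod_cast hk)
  have hsurj : (fderiv ℝ f x).range = ⊤ := by
    apply LinearMap.range_eq_top.2
    exact LinearMap.surjective (fun h => hne (by ext v; exact congrArg (fun L => L v) h))
  obtain ⟨P, hP⟩ : (fderiv ℝ f x).ker.ClosedComplemented :=
    Submodule.ClosedComplemented.of_finiteDimensional_quotient
      (Submodule.closed_of_finiteDimensional _)
  let D : ImplicitFunctionData ℝ E ℝ (fderiv ℝ f x).ker :=
    { leftFun := f
      leftDeriv := fderiv ℝ f x
      rightFun := P
      rightDeriv := P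
      pt := x
      hasStrictFDerivAt_leftFun := hstrict
      hasStrictFDerivAt_rightFun := P.hasStrictFDerivAt
      range_leftDeriv := hsurj
      range_rightDeriv := LinearMap.range_eq_of_proj hP
      isCompl_ker := LinearMap.isCompl_of_proj hP }
  set g : (fderiv ℝ f x).ker → E := D.implicitFunction 0 with hg
  have hgP : ∀ᶠ y in 𝓝 x, D.implicitFunction (f y) (P y) = y := D.implicitFunction_apply_image
  have hgC : ContDiffAt ℝ k g (P x) := by
    have h := D.contDiffAt_implicitFunction (n := (k : WithTop ℕ∞)) (hf x hx).1
      P.contDiff.contDiffAt (by exact_mod_cast hk)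
    have hpt : D.prodFun D.pt = (0, P x) := Prod.ext (hf x hx).2 rfl
    rw [hpt] at h
    exact h.comp (P x) (contDiffAt_const.prodMk contDiffAt_id)
  have hgC' : ∀ᶠ y in 𝓝 x, ContDiffAt ℝ k g (P y) :=
    P.continuous.continuousAt.eventually (hgC.eventually (by simp))
  have hrank : Module.finrank ℝ (fderiv ℝ f x).ker < Module.finrank ℝ E :=
    Submodule.finrank_lt fun h => hne (by
      ext v
      exact LinearMap.mem_ker.1 (h ▸ Submodule.mem_top : v ∈ (fderiv ℝ f x).ker))
  obtain ⟨𝓑, hc, hcov, hpiece⟩ := ih _ hrank {z | g z ∈ A ∧ ContDiffAt ℝ k g z}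
  refine ⟨{y ∈ A | g (P y) = y ∧ ContDiffAt ℝ k g (P y)}, ?_, (g '' ·) '' 𝓑, hc.image _, ?_, ?_⟩
  · filter_upwards [self_mem_nhdsWithin, nhdsWithin_le_nhds hgP, nhdsWithin_le_nhds hgC']
      with y hy h1 h2
    refine ⟨hy, ?_, h2⟩
    rwa [(hf y hy).2] at h1
  · rintro y ⟨hy, h1, h2⟩
    obtain ⟨B, hB, hyB⟩ := hcov (show P y ∈ {z | g z ∈ A ∧ ContDiffAt ℝ k g z} from
      ⟨h1.symm ▸ hy, h2⟩)
    exact ⟨_, ⟨B, hB, rfl⟩, P y, hyB, h1⟩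
  · rintro _ ⟨B, hB, rfl⟩
    exact (hpiece B hB).image hk g P (LinearMap.range_eq_top.1 (LinearMap.range_eq_of_proj hP))
      fun z hz => hz

/-- **Morse's decomposition**: every subset `A` of a finite-dimensional space is covered by countably
many Morse pieces. The induction is on the dimension, for the points outside the flat part, and
then on `k`, for the flat part. -/
theorem hasMorseCover (n : ℕ) : ∀ (E : Type) [NormedAddCommGroup E] [NormedSpace ℝ E]
    [FiniteDimensional ℝ E], Module.finrank ℝ E = n → ∀ (k : ℕ) (A : Set E),
    HasMorseCover k A A := by
  induction n using Nat.strong_induction_on with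
  | _ n ihn =>
  intro E _ _ _ hE k
  induction k with
  | zero => exact fun A => ⟨{A}, countable_singleton A, by simp, by simpa using isMorsePiece_zero A⟩
  | succ k ihk =>
    intro A
    have hloc : ∀ x ∈ A \ flatPart (k + 1) A, ∃ U ∈ 𝓝[A] x, HasMorseCover (k + 1) A U :=
      fun x hx => exists_nhds_hasMorseCover (Nat.succ_ne_zero k)
        (fun V hV A' => ihn _ (hE ▸ hV) V rfl (k + 1) A') hx.1 hx.2
    choose! U hU hUc using hloc
    obtain ⟨t, htA, htc, htU⟩ := TopologicalSpace.countable_cover_nhdsWithin (f := U)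
      (s := A \ flatPart (k + 1) A) fun x hx => nhdsWithin_mono x sdiff_subset (hU x hx)
    choose! 𝓑 hc hcov hpiece using hUc
    obtain ⟨𝓑', hc', hcov', hpiece'⟩ := ihk (flatPart (k + 1) A)
    refine ⟨𝓑' ∪ ⋃ x ∈ t, 𝓑 x, hc'.union (htc.biUnion fun x hx => hc x (htA hx)), ?_, ?_⟩
    · intro y hy
      by_cases hy' : y ∈ flatPart (k + 1) A
      · obtain ⟨B, hB, hyB⟩ := hcov' hy'
        exact ⟨B, .inl hB, hyB⟩
      · obtain ⟨x, hx, hyx⟩ := mem_iUnion₂.1 (htU ⟨hy, hy'⟩)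
        obtain ⟨B, hB, hyB⟩ := hcov x (htA hx) hyx
        exact ⟨B, .inr (mem_iUnion₂.2 ⟨x, hx, hB⟩), hyB⟩
    · rintro B (hB | hB)
      · exact (hpiece' B hB).of_flatPart
      · obtain ⟨x, hx, hB⟩ := mem_iUnion₂.1 hB
        exact hpiece x (htA hx) B hB

end

/-! ### Critical values -/

/-- On a cell of diameter less than `δ` the map `w` is Hölder on `T` with exponent the dimension and
constant `ε`, so it maps the `d`-dimensional Hausdorff measure, which is the volume, to at most `ε`
times the length. -/
theorem volume_image_inter_le {ι : Type*} [Fintype ι] [Nonempty ι] {w : (ι → ℝ) → ℝ} {ε : NNReal}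
    {δ : ℝ} (hδ : 0 < δ) {T K : Set (ι → ℝ)} (hK : MeasurableSet K)
    (h : ∀ x ∈ T, ∀ y, ‖y - x‖ < δ → ‖w y - w x‖ ≤ ε * ‖y - x‖ ^ Fintype.card ι) :
    volume (w '' (T ∩ K)) ≤ ε * volume K := by
  obtain ⟨q, hq⟩ := TopologicalSpace.exists_dense_seq (ι → ℝ)
  set D : ℕ → Set (ι → ℝ) := disjointed fun i => Metric.ball (q i) (δ / 2) with hD
  have hDm : ∀ i, MeasurableSet (D i) := MeasurableSet.disjointed fun i => measurableSet_ball
  have hDU : ⋃ i, D i = univ := by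
    rw [hD, iUnion_disjointed]
    refine eq_univ_of_forall fun x => ?_
    obtain ⟨i, hi⟩ := hq.exists_dist_lt x (half_pos hδ)
    exact mem_iUnion.2 ⟨i, hi⟩
  have hpiece : ∀ i, volume (w '' (T ∩ (K ∩ D i))) ≤ ε * volume (K ∩ D i) := by
    intro i
    have hH : HolderOnWith ε (Fintype.card ι) w (T ∩ (K ∩ D i)) := by
      intro x hx y hy
      have hx' := disjointed_subset _ _ hx.2.2
      have hy' := disjointed_subset _ _ hy.2.2
      have hd : ‖x - y‖ < δ := by
        rw [← dist_eq_norm]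
        have := dist_triangle_right x y (q i)
        rw [Metric.mem_ball] at hx' hy'
        linarith
      have := h y hy.1 x hd
      rw [edist_nndist, edist_nndist, NNReal.coe_natCast, ENNReal.rpow_natCast]
      rw [← dist_eq_norm, ← dist_eq_norm] at this
      exact_mod_cast this
    have := hH.hausdorffMeasure_image_le (by exact_mod_cast Fintype.card_pos) (d := 1) zero_le_one
    rw [hausdorffMeasure_real, ENNReal.rpow_one, mul_one, NNReal.coe_natCast,
      hausdorffMeasure_pi_real] at this
    exact this.trans (mul_le_mul' le_rfl (measure_mono inter_subset_right))
  have hcov : w '' (T ∩ K) ⊆ ⋃ i, w '' (T ∩ (K ∩ D i)) := by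
    rw [← image_iUnion, ← inter_iUnion, ← inter_iUnion, hDU, inter_univ]
  calc volume (w '' (T ∩ K)) ≤ volume (⋃ i, w '' (T ∩ (K ∩ D i))) := measure_mono hcov
    _ ≤ ∑' i, volume (w '' (T ∩ (K ∩ D i))) := measure_iUnion_le _
    _ ≤ ∑' i, ε * volume (K ∩ D i) := ENNReal.tsum_le_tsum hpiece
    _ = ε * volume K := by
      rw [ENNReal.tsum_mul_left, ← measure_iUnion _ fun i => hK.inter (hDm i), ← inter_iUnion, hDU,
        inter_univ]
      exact fun i j hij => ((disjoint_disjointed _) hij).mono inter_subset_right inter_subset_right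

theorem volume_image_eq_zero_of_isLittleO {ι : Type*} [Fintype ι] [Nonempty ι]
    {w : (ι → ℝ) → ℝ} {T : Set (ι → ℝ)}
    (h : ∀ x ∈ T, (fun y => w y - w x) =o[𝓝 x] fun y => ‖y - x‖ ^ Fintype.card ι) :
    volume (w '' T) = 0 := by
  have hε : ∀ (R : ℕ) (ε : NNReal), 0 < ε →
      volume (w '' (T ∩ Metric.ball 0 R)) ≤ ε * volume (Metric.ball (0 : ι → ℝ) R) := by
    intro R ε hε
    let S : ℕ → Set (ι → ℝ) := fun j =>
      {x ∈ T | ∀ y, ‖y - x‖ < 1 / ((j : ℝ) + 1) → ‖w y - w x‖ ≤ ε * ‖y - x‖ ^ Fintype.card ι}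
    have hmono : Monotone fun j => w '' (S j ∩ Metric.ball 0 R) := by
      intro i j hij
      refine image_mono (inter_subset_inter_left _ fun x hx => ⟨hx.1, fun y hy => hx.2 y ?_⟩)
      exact hy.trans_le (Nat.one_div_le_one_div hij)
    have hcov : w '' (T ∩ Metric.ball 0 R) ⊆ ⋃ j, w '' (S j ∩ Metric.ball 0 R) := by
      rw [← image_iUnion, ← iUnion_inter]
      refine image_mono (inter_subset_inter_left _ fun x hx => ?_)
      obtain ⟨δ, hδ, hball⟩ := Metric.eventually_nhds_iff.1 (isLittleO_iff.1 (h x hx) hε)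
      obtain ⟨j, hj⟩ := exists_nat_one_div_lt hδ
      refine mem_iUnion.2 ⟨j, hx, fun y hy => ?_⟩
      simpa using hball (y := y) (by rw [dist_eq_norm]; exact hy.trans hj)
    refine (measure_mono hcov).trans ?_
    rw [hmono.measure_iUnion]
    exact iSup_le fun j => volume_image_inter_le (by positivity) measurableSet_ball fun x hx => hx.2
  have hzero : ∀ R : ℕ, volume (w '' (T ∩ Metric.ball 0 R)) = 0 := by
    intro R
    have hfin : volume (Metric.ball (0 : ι → ℝ) R) ≠ ⊤ := measure_ball_lt_top.ne
    have ht : Tendsto (fun ε : NNReal => (ε : ENNReal) * volume (Metric.ball (0 : ι → ℝ) R))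
        (𝓝[>] 0) (𝓝 0) := by
      have : Tendsto (fun ε : NNReal => (ε : ENNReal)) (𝓝[>] 0) (𝓝 0) :=
        (ENNReal.tendsto_coe.2 tendsto_id).mono_left nhdsWithin_le_nhds
      simpa using ENNReal.Tendsto.mul_const this (.inr hfin)
    exact le_antisymm (ge_of_tendsto ht (eventually_nhdsWithin_of_forall fun ε hε' => hε R ε hε'))
      zero_le
  have hcov : w '' T ⊆ ⋃ R : ℕ, w '' (T ∩ Metric.ball 0 R) := by
    rw [← image_iUnion, ← inter_iUnion, Metric.iUnion_ball_nat, inter_univ]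
  exact measure_mono_null hcov (measure_iUnion_null hzero)

/-- The **Morse-Sard theorem** for real functions, at the sharp regularity: the critical values of a
`C ^ d` function of `d ≥ 1` variables form a null set. -/
theorem volume_image_critical_eq_zero {ι : Type} [Fintype ι] [Nonempty ι] {u : (ι → ℝ) → ℝ}
    (hu : ContDiff ℝ (Fintype.card ι) u) : volume (u '' {x | fderiv ℝ u x = 0}) = 0 := by
  obtain ⟨k, hk⟩ : ∃ k, Fintype.card ι = k + 1 :=
    ⟨_, (Nat.succ_pred_eq_of_pos Fintype.card_pos).symm⟩
  rw [hk] at hu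
  have hdiff : Differentiable ℝ u := hu.differentiable (by simp)
  obtain ⟨𝓑, hc, hcov, hpiece⟩ := hasMorseCover _ (ι → ℝ) rfl k {x | fderiv ℝ u x = 0}
  have hnull : ∀ B ∈ 𝓑, volume (u '' B) = 0 := by
    intro B hB
    obtain ⟨φ, T, hBT, -, hφ, hlit⟩ := hpiece B hB
    have h := hlit _ (fderiv ℝ u) fun a ha => ⟨(hu.fderiv_right (by norm_cast)).contDiffAt, ha⟩
    refine measure_mono_null (image_mono hBT) ?_
    rw [← image_comp]
    refine volume_image_eq_zero_of_isLittleO fun x hx => ?_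
    rw [hk]
    exact fderiv_comp_isLittleO (f := u) (hφ x hx) (Eventually.of_forall fun y => hdiff y) (h x hx)
  refine measure_mono_null (image_mono hcov) ?_
  rw [sUnion_eq_biUnion, image_iUnion₂]
  exact (measure_biUnion_null_iff hc).2 hnull

theorem eq_of_isPreconnected_critical {ι : Type} [Fintype ι] [Nonempty ι] {u : (ι → ℝ) → ℝ}
    (hu : ContDiff ℝ (Fintype.card ι) u) (hS : IsPreconnected {x | fderiv ℝ u x = 0})
    {x y : ι → ℝ} (hx : fderiv ℝ u x = 0) (hy : fderiv ℝ u y = 0) : u x = u y := by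
  wlog h : u x < u y generalizing x y
  · rcases lt_trichotomy (u x) (u y) with h1 | h1 | h1
    exacts [(h h1).elim, h1, (this hy hx h1).symm]
  have hI : Icc (u x) (u y) ⊆ u '' {x | fderiv ℝ u x = 0} :=
    (hS.image u hu.continuous.continuousOn).Icc_subset ⟨x, hx, rfl⟩ ⟨y, hy, rfl⟩
  have := measure_mono_null hI (volume_image_critical_eq_zero hu)
  rw [Real.volume_Icc, ENNReal.ofReal_eq_zero] at this
  linarith

/-! ### Morrey's inequality on a cube -/

theorem enorm_sub_le_lintegral_segment {V : Type*} [NormedAddCommGroup V] [NormedSpace ℝ V]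
    {w : V → ℝ} (hw : ContDiff ℝ 1 w) (x y : V) :
    ‖w y - w x‖ₑ ≤ ‖y - x‖ₑ * ∫⁻ t in Ioc (0 : ℝ) 1, ‖fderiv ℝ w (x + t • (y - x))‖ₑ := by
  have hγ : ∀ t : ℝ, HasDerivAt (fun t : ℝ => w (x + t • (y - x)))
      (fderiv ℝ w (x + t • (y - x)) (y - x)) t := by
    intro t
    have h1 : HasDerivAt (fun t : ℝ => x + t • (y - x)) (y - x) t := by
      simpa using ((hasDerivAt_id t).smul_const (y - x)).const_add x
    exact ((hw.differentiable (by simp)) _).hasFDerivAt.comp_hasDerivAt t h1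
  have hcont : Continuous fun t : ℝ => fderiv ℝ w (x + t • (y - x)) :=
    (hw.continuous_fderiv (by simp)).comp (by fun_prop)
  have hftc := intervalIntegral.integral_eq_sub_of_hasDerivAt (a := 0) (b := 1)
    (fun t _ => hγ t) ((hcont.clm_apply continuous_const).intervalIntegrable _ _)
  simp only [one_smul, zero_smul, add_zero, add_sub_cancel] at hftc
  rw [← hftc, intervalIntegral.integral_of_le zero_le_one]
  refine (enorm_integral_le_lintegral_enorm _).trans ?_
  rw [← lintegral_const_mul _ hcont.enorm.measurable]
  refine lintegral_mono fun t => ?_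
  rw [mul_comm]
  exact (fderiv ℝ w (x + t • (y - x))).le_opENorm _

theorem lintegral_comp_homothety {n : ℕ} {t : ℝ} (ht : 0 < t) (x : Fin n → ℝ)
    {G : (Fin n → ℝ) → ENNReal} (hG : Measurable G) :
    ∫⁻ y, G (x + t • (y - x)) = ENNReal.ofReal (t ^ (-(n : ℝ))) * ∫⁻ y, G y := by
  have h1 : ∀ y, x + t • (y - x) = (x - t • x) + t • y := fun y => by
    rw [smul_sub]; abel
  simp_rw [h1]
  have hm : Measurable fun y => G ((x - t • x) + y) := hG.comp (measurable_const_add _)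
  rw [← lintegral_map (f := fun y => G ((x - t • x) + y)) hm (measurable_const_smul t),
    Measure.map_addHaar_smul _ ht.ne', lintegral_smul_measure, lintegral_add_left_eq_self,
    Module.finrank_fin_fun, abs_of_pos (by positivity), Real.rpow_neg ht.le, Real.rpow_natCast,
    smul_eq_mul]

/-- Hölder's inequality with exponents `n + 1` and `(n + 1) / n`, followed by the change of variables
`z = x + t (y - x)`, which maps the convex set `K` into itself. -/
theorem setLIntegral_comp_homothety_le {n : ℕ} {t : ℝ} (ht : t ∈ Ioc (0 : ℝ) 1)
    {K : Set (Fin n → ℝ)} (hK : Convex ℝ K) (hKm : MeasurableSet K) {x : Fin n → ℝ} (hx : x ∈ K)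
    {h : (Fin n → ℝ) → ENNReal} (hh : Measurable h) :
    ∫⁻ y in K, h (x + t • (y - x)) ≤ volume K ^ ((n : ℝ) / (n + 1)) *
      (ENNReal.ofReal (t ^ (-(n : ℝ))) * ∫⁻ y in K, h y ^ (n + 1)) ^ (1 / ((n : ℝ) + 1)) := by
  have hn : (0 : ℝ) < n + 1 := by positivity
  have hm : Measurable fun y => h (x + t • (y - x)) := hh.comp (by fun_prop)
  have hH := ENNReal.lintegral_mul_norm_pow_le (μ := volume.restrict K)
    (f := fun y => h (x + t • (y - x)) ^ (n + 1)) (g := fun _ => 1)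
    (hm.pow_const _).aemeasurable aemeasurable_const
    (p := 1 / ((n : ℝ) + 1)) (q := (n : ℝ) / (n + 1)) (by positivity) (by positivity)
    (by field_simp; ring)
  have hpow : ∀ a : ENNReal, (a ^ (n + 1)) ^ (1 / ((n : ℝ) + 1)) = a := fun a => by
    rw [← ENNReal.rpow_natCast, ← ENNReal.rpow_mul]
    push_cast
    rw [mul_one_div_cancel hn.ne', ENNReal.rpow_one]
  simp only [hpow, ENNReal.one_rpow, mul_one, setLIntegral_one] at hH
  refine hH.trans ?_
  rw [mul_comm]
  gcongr
  rw [← lintegral_indicator hKm (fun y => h y ^ (n + 1)),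
    ← lintegral_comp_homothety ht.1 x ((hh.pow_const _).indicator hKm), ← lintegral_indicator hKm]
  refine lintegral_mono fun y => ?_
  by_cases hy : y ∈ K
  · have : x + t • (y - x) ∈ K := hK.add_smul_sub_mem hx hy ⟨ht.1.le, ht.2⟩
    simp [hy, this]
  · simp [hy]

/-- The integral of `t ^ (-n / (n + 1))` over `(0, 1]`, which enters Morrey's inequality. The exponent
is written as it arises from the change of variables. -/
noncomputable def morreyConst (n : ℕ) : ENNReal :=
  ∫⁻ t in Ioc (0 : ℝ) 1, ENNReal.ofReal (t ^ (-(n : ℝ))) ^ (1 / ((n : ℝ) + 1))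

theorem morreyConst_lt_top (n : ℕ) : morreyConst n < ⊤ := by
  have hn : (0 : ℝ) < n + 1 := by positivity
  have hi : IntervalIntegrable (fun t : ℝ => t ^ (-((n : ℝ) / (n + 1)))) volume 0 1 :=
    intervalIntegral.intervalIntegrable_rpow' (by
      rw [neg_lt_neg_iff, div_lt_one hn]; linarith)
  rw [intervalIntegrable_iff_integrableOn_Ioc_of_le zero_le_one] at hi
  refine lt_of_eq_of_lt ?_ hi.lintegral_lt_top
  refine setLIntegral_congr_fun measurableSet_Ioc fun t ht => ?_
  have ht0 : 0 < t := ht.1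
  rw [ENNReal.ofReal_rpow_of_pos (by positivity), ← Real.rpow_mul ht0.le]
  congr 2
  ring

theorem setLIntegral_enorm_sub_le {n : ℕ} {w : (Fin n → ℝ) → ℝ} (hw : ContDiff ℝ 1 w) {ρ : ℝ}
    {x : Fin n → ℝ} (hx : x ∈ Metric.closedBall (0 : Fin n → ℝ) ρ) :
    ∫⁻ y in Metric.closedBall (0 : Fin n → ℝ) ρ, ‖w y - w x‖ₑ ≤
      ENNReal.ofReal (2 * ρ) * (volume (Metric.closedBall (0 : Fin n → ℝ) ρ) ^ ((n : ℝ) / (n + 1)) *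
        (morreyConst n *
        (∫⁻ y in Metric.closedBall (0 : Fin n → ℝ) ρ, ‖fderiv ℝ w y‖ₑ ^ (n + 1)) ^
          (1 / ((n : ℝ) + 1)))) := by
  set K := Metric.closedBall (0 : Fin n → ℝ) ρ with hK
  have hKm : MeasurableSet K := measurableSet_closedBall
  have hh : Measurable fun y => ‖fderiv ℝ w y‖ₑ :=
    (hw.continuous_fderiv (by simp)).enorm.measurable
  have hc : Continuous fun p : (Fin n → ℝ) × ℝ => ‖fderiv ℝ w (x + p.2 • (p.1 - x))‖ₑ :=
    ((hw.continuous_fderiv (by simp)).comp (by fun_prop)).enorm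
  calc ∫⁻ y in K, ‖w y - w x‖ₑ
      ≤ ∫⁻ y in K, ENNReal.ofReal (2 * ρ) *
          ∫⁻ t in Ioc (0 : ℝ) 1, ‖fderiv ℝ w (x + t • (y - x))‖ₑ := by
        refine setLIntegral_mono' hKm fun y hy => (enorm_sub_le_lintegral_segment hw x y).trans ?_
        gcongr
        rw [← ofReal_norm]
        apply ENNReal.ofReal_le_ofReal
        rw [hK, mem_closedBall_zero_iff] at hx hy
        linarith [norm_sub_le y x]
    _ = ENNReal.ofReal (2 * ρ) *
          ∫⁻ t in Ioc (0 : ℝ) 1, ∫⁻ y in K, ‖fderiv ℝ w (x + t • (y - x))‖ₑ := by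
        rw [lintegral_const_mul _ hc.measurable.lintegral_prod_right',
          lintegral_lintegral_swap hc.measurable.aemeasurable]
    _ ≤ ENNReal.ofReal (2 * ρ) * ∫⁻ t in Ioc (0 : ℝ) 1, volume K ^ ((n : ℝ) / (n + 1)) *
          (ENNReal.ofReal (t ^ (-(n : ℝ))) * ∫⁻ y in K, ‖fderiv ℝ w y‖ₑ ^ (n + 1)) ^
            (1 / ((n : ℝ) + 1)) := by
        refine mul_le_mul' le_rfl ?_
        exact setLIntegral_mono' measurableSet_Ioc fun t ht =>
          setLIntegral_comp_homothety_le ht (convex_closedBall _ _) hKm hx hh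
    _ = _ := by
        have hm : Measurable fun t : ℝ =>
            ENNReal.ofReal (t ^ (-(n : ℝ))) ^ (1 / ((n : ℝ) + 1)) := by fun_prop
        simp_rw [ENNReal.mul_rpow_of_nonneg _ _ (show (0 : ℝ) ≤ 1 / ((n : ℝ) + 1) by positivity)]
        rw [lintegral_const_mul _ (hm.mul_const _), lintegral_mul_const _ hm, morreyConst]

/-- **Morrey's inequality** on a cube of dimension `n`, with exponent `n + 1`. Both values `w x` and
`w x'` are compared with `w y`, averaged over `y` in the cube. -/
theorem enorm_sub_le_morrey {n : ℕ} {w : (Fin n → ℝ) → ℝ} (hw : ContDiff ℝ 1 w) {ρ : ℝ}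
    (hρ : 0 < ρ) {x x' : Fin n → ℝ} (hx : ‖x‖ ≤ ρ) (hx' : ‖x'‖ ≤ ρ) :
    ‖w x - w x'‖ₑ ≤ 2 * morreyConst n * (ENNReal.ofReal (2 * ρ) *
      ∫⁻ y in Metric.closedBall (0 : Fin n → ℝ) ρ, ‖fderiv ℝ w y‖ₑ ^ (n + 1)) ^
        (1 / ((n : ℝ) + 1)) := by
  have hn : (0 : ℝ) < n + 1 := by positivity
  set a := ENNReal.ofReal (2 * ρ) with ha
  have ha0 : a ≠ 0 := by simp [ha, hρ]
  have hat : a ≠ ⊤ := ENNReal.ofReal_ne_top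
  have hvol : volume (Metric.closedBall (0 : Fin n → ℝ) ρ) = a ^ n := by
    rw [Real.volume_pi_closedBall _ hρ.le, Fintype.card_fin, ENNReal.ofReal_pow (by positivity)]
  have h1 := setLIntegral_enorm_sub_le hw (mem_closedBall_zero_iff.2 hx)
  have h2 := setLIntegral_enorm_sub_le hw (mem_closedBall_zero_iff.2 hx')
  set K := Metric.closedBall (0 : Fin n → ℝ) ρ with hK
  set I := ∫⁻ y in K, ‖fderiv ℝ w y‖ₑ ^ (n + 1) with hI
  have hmeas : Measurable fun y => ‖w y - w x‖ₑ :=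
    (hw.continuous.sub continuous_const).enorm.measurable
  have hsum : a ^ n * ‖w x - w x'‖ₑ ≤
      (∫⁻ y in K, ‖w y - w x‖ₑ) + ∫⁻ y in K, ‖w y - w x'‖ₑ := by
    rw [← lintegral_add_left hmeas, ← hvol, mul_comm, ← setLIntegral_const]
    refine lintegral_mono fun y => ?_
    have : w x - w x' = (w y - w x') - (w y - w x) := by ring
    rw [this, add_comm]
    exact enorm_sub_le
  -- `1 + n * (n / (n + 1)) = n + 1 / (n + 1)`
  have hpow : a * (a ^ n) ^ ((n : ℝ) / (n + 1)) = a ^ n * a ^ (1 / ((n : ℝ) + 1)) := by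
    rw [← ENNReal.rpow_natCast, ← ENNReal.rpow_mul, ← ENNReal.rpow_add _ _ ha0 hat]
    nth_rw 1 [← ENNReal.rpow_one a]
    rw [← ENNReal.rpow_add _ _ ha0 hat]
    congr 1
    field_simp
    ring
  have hfin : a ^ n * ‖w x - w x'‖ₑ ≤
      a ^ n * (2 * morreyConst n * (a * I) ^ (1 / ((n : ℝ) + 1))) := by
    refine (hsum.trans (add_le_add h1 h2)).trans_eq ?_
    rw [hvol, ← mul_assoc, hpow, ENNReal.mul_rpow_of_nonneg _ _ (by positivity)]
    ring
  rwa [ENNReal.mul_le_mul_iff_right (pow_ne_zero _ ha0) (ENNReal.pow_ne_top hat)] at hfin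

/-! ### Spheres of small oscillation -/

theorem enorm_fderiv_slice_le {n : ℕ} {v : (Fin (n + 1) → ℝ) → ℝ} (hv : Differentiable ℝ v)
    (i : Fin (n + 1)) (t : ℝ) (z : Fin n → ℝ) :
    ‖fderiv ℝ (fun z => v (i.insertNth t z)) z‖ₑ ≤ ‖fderiv ℝ v (i.insertNth t z)‖ₑ := by
  let L : (Fin n → ℝ) →L[ℝ] (Fin (n + 1) → ℝ) :=
    ContinuousLinearMap.pi (i.insertNth 0 fun k => ContinuousLinearMap.proj k)
  have hL : ∀ z, (i.insertNth t z : Fin (n + 1) → ℝ) = i.insertNth t 0 + L z := by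
    intro z
    ext j
    refine Fin.succAboveCases i ?_ (fun k => ?_) j <;> simp [L]
  have hLn : ‖L‖ ≤ 1 := by
    refine L.opNorm_le_bound zero_le_one fun z => ?_
    rw [one_mul, pi_norm_le_iff_of_nonneg (norm_nonneg _)]
    intro j
    refine Fin.succAboveCases i ?_ (fun k => ?_) j
    · simp [L]
    · simpa [L] using norm_le_pi_norm z k
  have hd : HasFDerivAt (fun z : Fin n → ℝ => (i.insertNth t z : Fin (n + 1) → ℝ)) L z :=
    (L.hasFDerivAt.const_add (i.insertNth t 0)).congr_of_eventuallyEq (Eventually.of_forall hL)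
  have hcomp : HasFDerivAt (fun z => v (i.insertNth t z)) ((fderiv ℝ v (i.insertNth t z)).comp L) z :=
    (hv _).hasFDerivAt.comp z hd
  rw [hcomp.fderiv, ← ofReal_norm, ← ofReal_norm]
  refine ENNReal.ofReal_le_ofReal ((ContinuousLinearMap.opNorm_comp_le _ _).trans ?_)
  exact mul_le_of_le_one_right (norm_nonneg _) hLn

theorem contDiff_slice {n : ℕ} {v : (Fin (n + 1) → ℝ) → ℝ} (hv : ContDiff ℝ 1 v)
    (i : Fin (n + 1)) (t : ℝ) : ContDiff ℝ 1 fun z : Fin n → ℝ => v (i.insertNth t z) := by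
  refine hv.comp (contDiff_pi.2 fun j => ?_)
  refine Fin.succAboveCases i ?_ (fun k => ?_) j
  · simpa using contDiff_const
  · simpa using contDiff_apply ℝ ℝ k

theorem measurable_insertNth {n : ℕ} (i : Fin (n + 1)) :
    Measurable fun p : ℝ × (Fin n → ℝ) => (i.insertNth p.1 p.2 : Fin (n + 1) → ℝ) :=
  (MeasurableEquiv.piFinSuccAbove (fun _ : Fin (n + 1) => ℝ) i).symm.measurable

theorem lintegral_eq_lintegral_insertNth {n : ℕ} (i : Fin (n + 1))
    {F : (Fin (n + 1) → ℝ) → ENNReal} (hF : Measurable F) :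
    ∫⁻ x, F x = ∫⁻ t : ℝ, ∫⁻ z : Fin n → ℝ, F (i.insertNth t z) := by
  rw [← ((volume_preserving_piFinSuccAbove (fun _ : Fin (n + 1) => ℝ) i).symm).lintegral_comp hF,
    Measure.volume_eq_prod]
  exact lintegral_prod _ (hF.comp (measurable_insertNth i)).aemeasurable

/-- Some radius `r` in `[R, 2R]` is good for all the hyperplanes `x i = ± r` at once: the sum of
the slice integrals over them is at most its average over `[R, 2R]`. -/
theorem exists_radius_setLIntegral_slice_le {n : ℕ} {H : (Fin (n + 1) → ℝ) → ENNReal}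
    (hH : Measurable H) {R : ℝ} (hR : 0 < R) :
    ∃ r ∈ Icc R (2 * R), ∀ i : Fin (n + 1), ∀ s : ℝ, |s| = r → ∀ K : Set (Fin n → ℝ),
      ∫⁻ z in K, H (i.insertNth s z) ≤
        2 * (n + 1) * (∫⁻ x in {x | R ≤ ‖x‖}, H x) / ENNReal.ofReal R := by
  have hset : MeasurableSet {x : Fin (n + 1) → ℝ | R ≤ ‖x‖} :=
    measurableSet_le measurable_const measurable_norm
  set F := {x : Fin (n + 1) → ℝ | R ≤ ‖x‖}.indicator H with hF
  have hFm : Measurable F := hH.indicator hset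
  let J : Fin (n + 1) → ℝ → ENNReal := fun i t => ∫⁻ z : Fin n → ℝ, F (i.insertNth t z)
  have hJm : ∀ i, Measurable (J i) := fun i =>
    (hFm.comp (measurable_insertNth i)).lintegral_prod_right'
  have hJm' : ∀ i, Measurable fun t => J i t + J i (-t) := fun i =>
    (hJm i).add ((hJm i).comp measurable_neg)
  have hJ : ∀ i, ∫⁻ t, J i t = ∫⁻ x in {x | R ≤ ‖x‖}, H x := fun i => by
    rw [← lintegral_eq_lintegral_insertNth i hFm, hF, lintegral_indicator hset]
  have htot : ∫⁻ t, ∑ i, (J i t + J i (-t)) = 2 * (n + 1) * ∫⁻ x in {x | R ≤ ‖x‖}, H x := by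
    rw [lintegral_finsetSum _ fun i _ => hJm' i]
    have : ∀ i, ∫⁻ t, (J i t + J i (-t)) = 2 * ∫⁻ x in {x | R ≤ ‖x‖}, H x := fun i => by
      rw [lintegral_add_left (hJm i), lintegral_neg_eq_self, hJ, two_mul]
    simp_rw [this]
    rw [Finset.sum_const, Finset.card_univ, Fintype.card_fin, nsmul_eq_mul]
    push_cast
    ring
  have hvol : volume (Icc R (2 * R)) = ENNReal.ofReal R := by
    rw [Real.volume_Icc]; congr 1; ring
  obtain ⟨r, hr, hle⟩ := exists_le_setLAverage (μ := volume) (s := Icc R (2 * R))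
    (f := fun t => ∑ i, (J i t + J i (-t))) (by simp [hvol, hR]) (by simp [hvol])
    (Finset.measurable_sum _ fun i _ => hJm' i).aemeasurable
  refine ⟨r, hr, fun i s hs K => ?_⟩
  rw [setLAverage_eq, hvol] at hle
  refine le_trans ?_ (hle.trans (ENNReal.div_le_div_right
    ((setLIntegral_le_lintegral _ _).trans_eq htot) _))
  have hJs : J i s ≤ J i r + J i (-r) := by
    rcases (abs_eq (hR.le.trans hr.1)).1 hs with rfl | rfl
    exacts [le_self_add, le_add_self]
  refine le_trans ?_ (hJs.trans (Finset.single_le_sum (f := fun i => J i r + J i (-r))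
    (fun _ _ => zero_le) (Finset.mem_univ i)))
  refine (setLIntegral_le_lintegral _ _).trans (lintegral_mono fun z => ?_)
  have hmem : R ≤ ‖(i.insertNth s z : Fin (n + 1) → ℝ)‖ := by
    have := norm_le_pi_norm (i.insertNth s z : Fin (n + 1) → ℝ) i
    rw [Fin.insertNth_apply_same, Real.norm_eq_abs, hs] at this
    exact hr.1.trans this
  rw [hF, indicator_of_mem (show _ ∈ {x : Fin (n + 1) → ℝ | R ≤ ‖x‖} from hmem)]

theorem tendsto_setLIntegral_norm_ge {V : Type*} [NormedAddCommGroup V] [MeasurableSpace V]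
    [BorelSpace V] {μ : Measure V} {H : V → ENNReal} (hH : Measurable H) (hfin : ∫⁻ x, H x ∂μ ≠ ⊤) :
    Tendsto (fun R : ℝ => ∫⁻ x in {x | R ≤ ‖x‖}, H x ∂μ) atTop (𝓝 0) := by
  have hset : ∀ R : ℝ, MeasurableSet {x : V | R ≤ ‖x‖} := fun R =>
    measurableSet_le measurable_const measurable_norm
  simp_rw [← lintegral_indicator (hset _)]
  have := tendsto_lintegral_filter_of_dominated_convergence' (μ := μ) (l := atTop)
    (F := fun R : ℝ => {x : V | R ≤ ‖x‖}.indicator H) (f := fun _ => 0) H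
    (Eventually.of_forall fun R => (hH.indicator (hset R)).aemeasurable)
    (Eventually.of_forall fun R => Eventually.of_forall fun x => indicator_le_self _ _ _) hfin
    (Eventually.of_forall fun x => ?_)
  · simpa using this
  · refine tendsto_const_nhds.congr' ?_
    filter_upwards [eventually_gt_atTop ‖x‖] with R hR
    simp [hR]

/-- There are arbitrarily large radii `r` for which `v` has small oscillation on each face of the
sup-norm sphere of radius `r`; a face is described by the common value `± r` of the `i`-th
coordinate. -/
theorem exists_radius_forall_face {n : ℕ} {v : (Fin (n + 1) → ℝ) → ℝ} (hv : ContDiff ℝ 1 v)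
    (hfin : ∫⁻ x, ‖fderiv ℝ v x‖ₑ ^ (n + 1) ≠ ⊤) {ε : ℝ} (hε : 0 < ε) (R₀ : ℝ) :
    ∃ r > R₀, ∀ (i : Fin (n + 1)) (x y : Fin (n + 1) → ℝ), |x i| = r → x i = y i → ‖x‖ ≤ r →
      ‖y‖ ≤ r → |v x - v y| ≤ ε := by
  set H : (Fin (n + 1) → ℝ) → ENNReal := fun x => ‖fderiv ℝ v x‖ₑ ^ (n + 1) with hHdef
  have hH : Measurable H := (hv.continuous_fderiv (by simp)).enorm.measurable.pow_const _
  have hp : (0 : ℝ) < 1 / ((n : ℝ) + 1) := by positivity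
  have hlim : Tendsto (fun R : ℝ => 2 * morreyConst n *
      (8 * (n + 1) * ∫⁻ x in {x | R ≤ ‖x‖}, H x) ^ (1 / ((n : ℝ) + 1))) atTop (𝓝 0) := by
    have h1 := ENNReal.Tendsto.const_mul (a := 8 * ((n : ENNReal) + 1))
      (tendsto_setLIntegral_norm_ge hH hfin) (.inr (by finiteness))
    have h2 := ((ENNReal.continuous_rpow_const (y := 1 / ((n : ℝ) + 1))).tendsto _).comp h1
    have h3 := ENNReal.Tendsto.const_mul (a := 2 * morreyConst n) h2
      (.inr (ENNReal.mul_ne_top (by simp) (morreyConst_lt_top n).ne))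
    rwa [mul_zero, ENNReal.zero_rpow_of_pos hp, mul_zero] at h3
  have hev := hlim.eventually (gt_mem_nhds (ENNReal.ofReal_pos.2 hε))
  obtain ⟨R, hRε, hR0, hRR⟩ :=
    (hev.and ((eventually_gt_atTop 0).and (eventually_gt_atTop R₀))).exists
  obtain ⟨r, hr, hslice⟩ := exists_radius_setLIntegral_slice_le hH hR0
  refine ⟨r, hRR.trans_le hr.1, fun i x y hxi hxy hx hy => ?_⟩
  have hrem : ∀ z : Fin (n + 1) → ℝ, ‖z‖ ≤ r → ‖i.removeNth z‖ ≤ 2 * R := fun z hz =>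
    ((pi_norm_le_iff_of_nonneg (norm_nonneg z)).2 fun j => norm_le_pi_norm z _).trans
      (hz.trans hr.2)
  have hM := enorm_sub_le_morrey (contDiff_slice hv i (x i)) (ρ := 2 * R) (by positivity)
    (hrem x hx) (hrem y hy)
  rw [Fin.insertNth_self_removeNth, hxy, Fin.insertNth_self_removeNth, ← hxy] at hM
  -- the side `4 * R` of the cube cancels the factor `1 / R` of the slice estimate
  have hI : ENNReal.ofReal (2 * (2 * R)) * ∫⁻ z in Metric.closedBall (0 : Fin n → ℝ) (2 * R),
      ‖fderiv ℝ (fun z => v (i.insertNth (x i) z)) z‖ₑ ^ (n + 1) ≤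
      8 * (n + 1) * ∫⁻ x in {x | R ≤ ‖x‖}, H x := by
    have h1 : ∫⁻ z in Metric.closedBall (0 : Fin n → ℝ) (2 * R),
        ‖fderiv ℝ (fun z => v (i.insertNth (x i) z)) z‖ₑ ^ (n + 1) ≤ _ :=
      (lintegral_mono fun z => by
        show _ ≤ H (i.insertNth (x i) z)
        exact pow_le_pow_left' (enorm_fderiv_slice_le (hv.differentiable (by simp)) i (x i) z) _).trans
        (hslice i (x i) hxi _)
    refine (mul_le_mul' le_rfl h1).trans_eq ?_
    have hR' : ENNReal.ofReal R ≠ 0 := by simpa using hR0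
    rw [show 2 * (2 * R) = 4 * R by ring, ENNReal.ofReal_mul (by norm_num),
      mul_assoc, ENNReal.mul_div_cancel hR' ENNReal.ofReal_ne_top, ENNReal.ofReal_ofNat]
    ring
  have hlt : ‖v x - v y‖ₑ ≤ ENNReal.ofReal ε := by
    refine (hM.trans ?_).trans hRε.le
    gcongr
  rw [← ofReal_norm, ENNReal.ofReal_le_ofReal_iff hε.le] at hlt
  exact hlt

/-- Two non-opposite faces of a cube of dimension at least two meet, so any two points of the sphere
are joined by at most four segments, each contained in a face. -/
theorem exists_radius_sphere_osc_le {n : ℕ} (hn : n ≠ 0) {v : (Fin (n + 1) → ℝ) → ℝ}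
    (hv : ContDiff ℝ 1 v) (hfin : ∫⁻ x, ‖fderiv ℝ v x‖ₑ ^ (n + 1) ≠ ⊤) {ε : ℝ} (hε : 0 < ε)
    (R₀ : ℝ) : ∃ r > R₀, ∀ x y, ‖x‖ = r → ‖y‖ = r → |v x - v y| ≤ ε := by
  obtain ⟨r, hr, hface⟩ := exists_radius_forall_face hv hfin (ε := ε / 4) (by positivity)
    (max R₀ 0)
  have hr0 : 0 < r := (le_max_right _ _).trans_lt hr
  have hadj : ∀ (i j : Fin (n + 1)) (x y : Fin (n + 1) → ℝ), i ≠ j → |x i| = r → |y j| = r →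
      ‖x‖ ≤ r → ‖y‖ ≤ r → |v x - v y| ≤ ε / 2 := by
    intro i j x y hij hxi hyj hx hy
    -- a point common to the two faces
    let p : Fin (n + 1) → ℝ := fun k => if k = i then x i else y k
    have hpi : x i = p i := by simp [p]
    have hpj : p j = y j := by simp [p, hij.symm]
    have hp : ‖p‖ ≤ r := by
      refine (pi_norm_le_iff_of_nonneg hr0.le).2 fun k => ?_
      by_cases hk : k = i
      · simp [p, hk, hxi]
      · simpa [p, hk] using (norm_le_pi_norm y k).trans hy
    have h1 := hface i x p hxi hpi hx hp
    have h2 := hface j p y (by rw [hpj, hyj]) hpj hp hy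
    linarith [abs_sub_le (v x) (v p) (v y)]
  refine ⟨r, (le_max_left _ _).trans_lt hr, fun x y hx hy => ?_⟩
  have hex : ∀ z : Fin (n + 1) → ℝ, ‖z‖ = r → ∃ i, |z i| = r := fun z hz => by
    by_contra! hne
    exact ((pi_norm_lt_iff hr0).2 fun i =>
      ((norm_le_pi_norm z i).trans_eq hz).lt_of_ne (hne i)).ne hz
  obtain ⟨i, hi⟩ := hex x hx
  obtain ⟨j, hj⟩ := hex y hy
  by_cases hij : i = j
  · subst hij
    have : Nontrivial (Fin (n + 1)) := Fin.nontrivial_iff_two_le.2 (by omega)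
    obtain ⟨k, hk⟩ := exists_ne i
    -- the corner `q` lies on a face adjacent to both faces of direction `i`
    let q : Fin (n + 1) → ℝ := fun _ => r
    have hq : ‖q‖ ≤ r := (pi_norm_le_iff_of_nonneg hr0.le).2 fun k => by
      simp [q, abs_of_pos hr0]
    have h1 := hadj i k x q hk.symm hi (abs_of_pos hr0) hx.le hq
    have h2 := hadj k i q y hk (abs_of_pos hr0) hj hq hy.le
    linarith [abs_sub_le (v x) (v q) (v y)]
  · linarith [hadj i j x y hij hi hj hx.le hy.le]

/-! ### Extrema between spheres -/

/-- A quasiconvex function on a half-line is eventually monotone or antitone: if it increases once, it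
is monotone from there on, and otherwise it is antitone. -/
theorem exists_tendsto_ereal_of_le_max {M : ℝ → ℝ} {R₀ : ℝ}
    (hM : ∀ a b c, R₀ < a → a < b → b < c → M b ≤ max (M a) (M c)) :
    ∃ L : EReal, Tendsto (fun r => (M r : EReal)) atTop (𝓝 L) := by
  by_cases h : ∃ a b, R₀ < a ∧ a < b ∧ M a < M b
  · obtain ⟨a, b, ha, hab, hlt⟩ := h
    have hb : ∀ t, b ≤ t → M b ≤ M t := by
      intro t ht
      rcases ht.eq_or_lt with rfl | ht
      · exact le_rfl
      · exact (le_max_iff.1 (hM a b t ha hab ht)).resolve_left hlt.not_ge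
    have hmono : Monotone fun r => (M (max r b) : EReal) := by
      intro s t hst
      refine EReal.coe_le_coe_iff.2 ?_
      rcases (max_le_max_right b hst).eq_or_lt with h | h
      · rw [h]
      · exact (le_max_iff.1 (hM a _ _ ha (hab.trans_le (le_max_right _ _)) h)).resolve_left
          (hlt.trans_le (hb _ (le_max_right _ _))).not_ge
    refine ⟨_, (tendsto_atTop_iSup hmono).congr' ?_⟩
    filter_upwards [eventually_ge_atTop b] with r hr
    rw [max_eq_left hr]
  · push Not at h
    have hanti : Antitone fun r => (M (max r (R₀ + 1)) : EReal) := by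
      intro s t hst
      refine EReal.coe_le_coe_iff.2 ?_
      rcases (max_le_max_right (R₀ + 1) hst).eq_or_lt with h' | h'
      · rw [h']
      · exact h _ _ ((lt_add_one R₀).trans_le (le_max_right _ _)) h'
    refine ⟨_, (tendsto_atTop_iInf hanti).congr' ?_⟩
    filter_upwards [eventually_ge_atTop (R₀ + 1)] with r hr
    rw [max_eq_left hr]

/-- The supremum of `v` over the sphere of radius `r` about the origin. -/
noncomputable def sphereSup {V : Type*} [NormedAddCommGroup V] (v : V → ℝ) (r : ℝ) : ℝ := sSup (v '' Metric.sphere 0 r)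

theorem le_sphereSup {V : Type*} [NormedAddCommGroup V] [ProperSpace V] {v : V → ℝ}
    (hv : Continuous v) (x : V) : v x ≤ sphereSup v ‖x‖ :=
  le_csSup ((isCompact_sphere 0 _).image hv).bddAbove ⟨x, by simp, rfl⟩

section

variable {V : Type*} [NormedAddCommGroup V] [NormedSpace ℝ V] [ProperSpace V]

theorem exists_ge_on_annulus {v : V → ℝ} (hv : Continuous v) {a c : ℝ} {x : V} (ha : a ≤ ‖x‖)
    (hc : ‖x‖ ≤ c) :
    ∃ p, a ≤ ‖p‖ ∧ ‖p‖ ≤ c ∧ v x ≤ v p ∧ (‖p‖ = a ∨ ‖p‖ = c ∨ fderiv ℝ v p = 0) := by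
  have hK : IsCompact {y : V | a ≤ ‖y‖ ∧ ‖y‖ ≤ c} := by
    refine (isCompact_closedBall (0 : V) c).of_isClosed_subset
      ((isClosed_le continuous_const continuous_norm).inter
        (isClosed_le continuous_norm continuous_const)) fun y hy => ?_
    exact mem_closedBall_zero_iff.2 hy.2
  obtain ⟨p, hp, hmax⟩ := hK.exists_isMaxOn ⟨x, ha, hc⟩ hv.continuousOn
  refine ⟨p, hp.1, hp.2, hmax (show x ∈ {y : V | a ≤ ‖y‖ ∧ ‖y‖ ≤ c} from ⟨ha, hc⟩), ?_⟩
  by_cases h1 : ‖p‖ = a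
  · exact .inl h1
  by_cases h2 : ‖p‖ = c
  · exact .inr (.inl h2)
  refine .inr (.inr (IsLocalMax.fderiv_eq_zero (hmax.isLocalMax ?_)))
  filter_upwards [continuous_norm.continuousAt.eventually (lt_mem_nhds (hp.1.lt_of_ne' h1)),
    continuous_norm.continuousAt.eventually (gt_mem_nhds (hp.2.lt_of_ne h2))] with y hy1 hy2
  exact ⟨hy1.le, hy2.le⟩

/-- The maximum of `v` between two spheres of small oscillation is attained on one of them, or at a
critical point; in each case it is at most `c + ε`. -/
theorem eventually_le_of_critical_meets_spheres {v : V → ℝ} (hv : Continuous v)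
    (hosc : ∀ ε > 0, ∀ R₀ : ℝ, ∃ r > R₀, ∀ x y, ‖x‖ = r → ‖y‖ = r → |v x - v y| ≤ ε)
    {c r₀ : ℝ} (hc : ∀ x, fderiv ℝ v x = 0 → v x = c)
    (hmeet : ∀ r ≥ r₀, ∃ x, ‖x‖ = r ∧ fderiv ℝ v x = 0) {ε : ℝ} (hε : 0 < ε) :
    ∀ᶠ x in Bornology.cobounded V, v x ≤ c + ε := by
  have hs : ∀ R, ∃ r > R, ∀ x, ‖x‖ = r → v x ≤ c + ε := by
    intro R
    obtain ⟨r, hr, h⟩ := hosc ε hε (max R r₀)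
    obtain ⟨z, hz, hz0⟩ := hmeet r ((le_max_right _ _).trans hr.le)
    refine ⟨r, (le_max_left _ _).trans_lt hr, fun x hx => ?_⟩
    have := (le_abs_self _).trans (h x z hx hz)
    linarith [hc z hz0]
  obtain ⟨r₁, -, h1⟩ := hs 0
  filter_upwards [tendsto_norm_cobounded_atTop.eventually_ge_atTop r₁] with x hx
  obtain ⟨r₂, hr₂, h2⟩ := hs ‖x‖
  obtain ⟨p, -, -, hxp, h | h | h⟩ := exists_ge_on_annulus hv hx hr₂.le
  · exact hxp.trans (h1 p h)
  · exact hxp.trans (h2 p h)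
  · linarith [hc p h]

theorem tendsto_cobounded_of_critical_meets_spheres {v : V → ℝ} (hv : Continuous v)
    (hosc : ∀ ε > 0, ∀ R₀ : ℝ, ∃ r > R₀, ∀ x y, ‖x‖ = r → ‖y‖ = r → |v x - v y| ≤ ε)
    {c r₀ : ℝ} (hc : ∀ x, fderiv ℝ v x = 0 → v x = c)
    (hmeet : ∀ r ≥ r₀, ∃ x, ‖x‖ = r ∧ fderiv ℝ v x = 0) :
    Tendsto v (Bornology.cobounded V) (𝓝 c) := by
  refine Metric.tendsto_nhds.2 fun ε hε => ?_
  have hneg : ∀ x, fderiv ℝ (fun x => -v x) x = 0 ↔ fderiv ℝ v x = 0 := fun x => by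
    simp [fderiv_fun_neg]
  have h2 := eventually_le_of_critical_meets_spheres (v := fun x => -v x) (c := -c) (r₀ := r₀)
    hv.neg (fun ε hε R => ?_) (fun x hx => by rw [hc x ((hneg x).1 hx)])
    (by simpa only [hneg] using hmeet) (half_pos hε)
  · filter_upwards [eventually_le_of_critical_meets_spheres hv hosc hc hmeet (half_pos hε), h2]
      with x hx1 hx2
    rw [Real.dist_eq, abs_lt]
    constructor <;> linarith
  · obtain ⟨r, hr, h⟩ := hosc ε hε R
    refine ⟨r, hr, fun x y hx hy => ?_⟩
    rw [neg_sub_neg]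
    exact h y x hy hx

variable [Nontrivial V]

theorem exists_eq_sphereSup {v : V → ℝ} (hv : Continuous v) {r : ℝ} (hr : 0 ≤ r) :
    ∃ x, ‖x‖ = r ∧ v x = sphereSup v r := by
  obtain ⟨x, hx, h⟩ := ((isCompact_sphere (0 : V) r).image hv).sSup_mem
    ((NormedSpace.sphere_nonempty.2 hr).image v)
  exact ⟨x, by simpa using hx, h⟩

theorem exists_tendsto_sphereSup {v : V → ℝ} (hv : Continuous v) {R₀ : ℝ}
    (hcrit : ∀ x, fderiv ℝ v x = 0 → ‖x‖ ≤ R₀) :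
    ∃ L : EReal, Tendsto (fun r => (sphereSup v r : EReal)) atTop (𝓝 L) := by
  refine exists_tendsto_ereal_of_le_max (R₀ := max R₀ 0) fun a b c ha hab hbc => ?_
  obtain ⟨x, rfl, hx⟩ := exists_eq_sphereSup hv
    (((le_max_right R₀ 0).trans_lt ha).trans hab).le
  obtain ⟨p, hpa, -, hxp, h | h | h⟩ := exists_ge_on_annulus hv hab.le hbc.le
  · rw [← hx, ← h]
    exact le_max_of_le_left (hxp.trans (le_sphereSup hv p))
  · rw [← hx, ← h]
    exact le_max_of_le_right (hxp.trans (le_sphereSup hv p))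
  · exact absurd ((hcrit p h).trans (le_max_left _ _)) (ha.trans_le hpa).not_ge

theorem exists_tendsto_cobounded_of_critical_bounded {v : V → ℝ} (hv : Continuous v)
    (hosc : ∀ ε > 0, ∀ R₀ : ℝ, ∃ r > R₀, ∀ x y, ‖x‖ = r → ‖y‖ = r → |v x - v y| ≤ ε)
    {R₀ : ℝ} (hcrit : ∀ x, fderiv ℝ v x = 0 → ‖x‖ ≤ R₀) :
    ∃ L : EReal, Tendsto (fun x => (v x : EReal)) (Bornology.cobounded V) (𝓝 L) := by
  obtain ⟨L, hL⟩ := exists_tendsto_sphereSup hv hcrit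
  have hvn : Continuous fun x => -v x := hv.neg
  obtain ⟨L', hL'⟩ := exists_tendsto_sphereSup hvn (R₀ := R₀) fun x hx =>
    hcrit x (by simpa [fderiv_fun_neg] using hx)
  have hinf : Tendsto (fun r => ((-sphereSup (fun x => -v x) r : ℝ) : EReal)) atTop (𝓝 (-L')) := by
    simp only [EReal.coe_neg]
    exact (continuous_neg.tendsto L').comp hL'
  have hle : ∀ x, -sphereSup (fun x => -v x) ‖x‖ ≤ v x := fun x => by
    linarith [le_sphereSup hvn x]
  have hLL : -L' = L := by
    refine le_antisymm (le_of_tendsto_of_tendsto hinf hL ?_) (le_of_not_gt fun hlt => ?_)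
    · filter_upwards [eventually_ge_atTop 0] with r hr
      obtain ⟨x, rfl, -⟩ := exists_eq_sphereSup hv hr
      exact EReal.coe_le_coe_iff.2 ((hle x).trans (le_sphereSup hv x))
    · -- a gap between the limits would persist on the spheres of small oscillation
      obtain ⟨a, ha, haL⟩ := EReal.lt_iff_exists_real_btwn.1 hlt
      obtain ⟨b, hab, hb⟩ := EReal.lt_iff_exists_real_btwn.1 haL
      have hab' : 0 < b - a := sub_pos.2 (EReal.coe_lt_coe_iff.1 hab)
      obtain ⟨R, hR⟩ := eventually_atTop.1
        ((hinf.eventually (gt_mem_nhds ha)).and (hL.eventually (lt_mem_nhds hb)))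
      obtain ⟨r, hr, hr'⟩ := hosc _ hab' (max R 0)
      have hr0 : 0 ≤ r := (le_max_right R 0).trans hr.le
      obtain ⟨h1, h2⟩ := hR r ((le_max_left R 0).trans hr.le)
      rw [EReal.coe_lt_coe_iff] at h1 h2
      obtain ⟨x, hx, hxM⟩ := exists_eq_sphereSup hv hr0
      obtain ⟨y, hy, hyM⟩ := exists_eq_sphereSup hvn hr0
      have := (le_abs_self _).trans (hr' x y hx hy)
      linarith
  rw [hLL] at hinf
  exact ⟨L, tendsto_of_tendsto_of_tendsto_of_le_of_le (hinf.comp tendsto_norm_cobounded_atTop)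
    (hL.comp tendsto_norm_cobounded_atTop) (fun x => EReal.coe_le_coe_iff.2 (hle x))
    fun x => EReal.coe_le_coe_iff.2 (le_sphereSup hv x)⟩

end

theorem exists_forall_norm_eq_of_isPreconnected {V : Type*} [NormedAddCommGroup V] {Z : Set V}
    (hZ : IsPreconnected Z) (hunb : ∀ R, ∃ x ∈ Z, R < ‖x‖) :
    ∃ r₀, ∀ r ≥ r₀, ∃ x, ‖x‖ = r ∧ x ∈ Z := by
  obtain ⟨z, hz, -⟩ := hunb 0
  refine ⟨‖z‖, fun r hr => ?_⟩
  obtain ⟨y, hy, hry⟩ := hunb r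
  obtain ⟨x, hx, hxr⟩ := (hZ.image _ continuous_norm.continuousOn).Icc_subset
    (mem_image_of_mem _ hz) (mem_image_of_mem _ hy) ⟨hr, hry.le⟩
  exact ⟨x, hxr, hx⟩

/-! ### Existence of the limit -/

theorem exists_tendsto_cobounded_pi {n : ℕ} (hn : n ≠ 0) {v : (Fin (n + 1) → ℝ) → ℝ}
    (hv : ContDiff ℝ 1 v) (hfin : ∫⁻ x, ‖fderiv ℝ v x‖ₑ ^ (n + 1) ≠ ⊤)
    (hcase : Bornology.IsBounded {x | fderiv ℝ v x = 0} ∨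
      (IsPreconnected {x | fderiv ℝ v x = 0} ∧ ContDiff ℝ (n + 1 : ℕ) v)) :
    ∃ L : EReal, Tendsto (fun x => (v x : EReal)) (Bornology.cobounded (Fin (n + 1) → ℝ)) (𝓝 L) := by
  have hosc : ∀ ε > 0, ∀ R₀ : ℝ, ∃ r > R₀, ∀ x y, ‖x‖ = r → ‖y‖ = r → |v x - v y| ≤ ε :=
    fun ε hε R₀ => exists_radius_sphere_osc_le hn hv hfin hε R₀
  by_cases hb : Bornology.IsBounded {x | fderiv ℝ v x = 0}
  · obtain ⟨R, hR⟩ := hb.exists_norm_le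
    exact exists_tendsto_cobounded_of_critical_bounded hv.continuous hosc hR
  · obtain ⟨hpre, hvN⟩ := hcase.resolve_left hb
    have hunb : ∀ R, ∃ x ∈ {x | fderiv ℝ v x = 0}, R < ‖x‖ := by
      intro R
      by_contra! h
      exact hb (isBounded_iff_forall_norm_le.2 ⟨R, h⟩)
    obtain ⟨r₀, hr₀⟩ := exists_forall_norm_eq_of_isPreconnected hpre hunb
    obtain ⟨z, -, hz⟩ := hr₀ r₀ le_rfl
    have hconst : ∀ x, fderiv ℝ v x = 0 → v x = v z := fun x hx =>
      eq_of_isPreconnected_critical (by simpa using hvN) hpre hx hz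
    exact ⟨_, (continuous_coe_real_ereal.tendsto _).comp
      (tendsto_cobounded_of_critical_meets_spheres hv.continuous hosc hconst hr₀)⟩

theorem proposition2p1 (N : ℕ) (hN : 2 ≤ N)
    (u : EuclideanSpace ℝ (Fin N) → ℝ) (hu : ContDiff ℝ 1 u)
    (hgrad : MemLp (fun x => gradient u x) (N : ENNReal) volume)
    (S : Set (EuclideanSpace ℝ (Fin N))) (hS : S = {x | gradient u x = 0})
    (hcase : IsCompact S ∨ (IsPreconnected S ∧ ContDiff ℝ (N : WithTop ℕ∞) u)) :
    ∃ L : EReal, Tendsto (fun x => (u x : EReal))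
      (Bornology.cobounded (EuclideanSpace ℝ (Fin N))) (𝓝 L) := by
  obtain ⟨n, rfl⟩ : ∃ n, N = n + 1 := ⟨N - 1, by omega⟩
  let e : (Fin (n + 1) → ℝ) ≃L[ℝ] EuclideanSpace ℝ (Fin (n + 1)) :=
    (EuclideanSpace.equiv (Fin (n + 1)) ℝ).symm
  have he : MeasurePreserving e := PiLp.volume_preserving_toLp (Fin (n + 1))
  have hfd : ∀ x, fderiv ℝ (u ∘ e) x = (fderiv ℝ u (e x)).comp (e : (Fin (n + 1) → ℝ) →L[ℝ] _) := fun x =>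
    e.comp_right_fderiv
  have hnorm : ∀ y, ‖gradient u y‖ₑ = ‖fderiv ℝ u y‖ₑ := fun y => by
    rw [gradient, LinearIsometryEquiv.enorm_map]
  have hZ : {x | fderiv ℝ (u ∘ e) x = 0} = e.symm '' S := by
    rw [hS, e.symm.image_eq_preimage_symm]
    ext x
    have h0 : gradient u (e x) = 0 ↔ fderiv ℝ u (e x) = 0 := by
      simp [gradient]
    simp only [mem_ofPred_eq, mem_preimage, ContinuousLinearEquiv.symm_symm, h0, hfd]
    refine ⟨fun h => ?_, fun h => by rw [h, ContinuousLinearMap.zero_comp]⟩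
    ext y
    simpa using congrArg (fun L => L (e.symm y)) h
  have hfin : ∫⁻ x, ‖fderiv ℝ (u ∘ e) x‖ₑ ^ (n + 1) ≠ ⊤ := by
    have h1 := lintegral_rpow_enorm_lt_top_of_eLpNorm_lt_top (by simp) (by simp) hgrad.2
    simp only [hnorm, ENNReal.toReal_natCast, ENNReal.rpow_natCast] at h1
    have hm : Measurable fun y => ‖fderiv ℝ u y‖ₑ ^ (n + 1) :=
      (hu.continuous_fderiv (by simp)).enorm.measurable.pow_const _
    rw [← he.lintegral_comp hm] at h1
    refine ne_top_of_le_ne_top (ENNReal.mul_ne_top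
      (ENNReal.pow_ne_top (n := n + 1) (enorm_ne_top
        (x := (e : (Fin (n + 1) → ℝ) →L[ℝ] EuclideanSpace ℝ (Fin (n + 1))))))
      h1.ne) ?_
    have hm' : Measurable fun x => ‖fderiv ℝ u (e x)‖ₑ ^ (n + 1) := hm.comp he.measurable
    rw [← lintegral_const_mul _ hm']
    refine lintegral_mono fun x => ?_
    rw [hfd, ← mul_pow, mul_comm]
    exact pow_le_pow_left' (ContinuousLinearMap.opENorm_comp_le _ _) _
  obtain ⟨L, hL⟩ := exists_tendsto_cobounded_pi (v := u ∘ e) (by omega) (hu.comp e.contDiff) hfin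
    (by
      rw [hZ]
      refine hcase.imp (fun h => (h.image e.symm.continuous).isBounded) fun h =>
        ⟨h.1.image _ e.symm.continuous.continuousOn, h.2.comp e.contDiff⟩)
  refine ⟨L, ?_⟩
  have hcob : Tendsto e.symm (Bornology.cobounded _) (Bornology.cobounded _) := by
    simp only [Metric.cobounded_eq_cocompact]
    exact e.symm.toHomeomorph.isClosedEmbedding.tendsto_cocompact
  simpa [Function.comp_def] using hL.comp hcob
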